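/- Let $n \ge 4$, $m \ge n+2$ and $p \ge m/2$ be integers. Let $f_1,\dots,f_m:\mathbb{R}^n\to\mathbb{R}$ be non-zero linear functionals whose only common zero is $0$, so that $$\|x\| = \Big(\sum_{i=1}^m |f_i(x)|^{2p}\Big)^{\frac1{2p}}$$ is a norm on $\mathbb{R}^n$, and let $X=(\mathbb{R}^n,\|\cdot\|)$. Let $0<\alpha\le\frac12$ be a real number such that for all $1\le j<k<l\le m$ and all $1\le i\le m$ with $i\notin\{j,k,l\}$, $$\operatorname{dist}\big(f_i,\operatorname{lin}\{f_j,f_k,f_l\}\big)\ge\alpha,$$ where the distance is measured in the dual norm $\|g\|^\star=\sup\{|g(x)|:\|x\|\le1\}$. Let $\beta>0$ be a real number such that for all $1\le j<k\le m$ and all $x\in\mathbb{R}^n$, $$\max\{|f_j(x)|,|f_k(x)|\}\le\beta\max_{1\le i\le m,\ i\notin\{j,k\}}|f_i(x)|.$$ For a subspace $Y\subset X$ let $\lambda(Y,X)$ be the infimum of the operator norms $\|P\|$ over all linear $P:X\to Y$ with $P|_Y=\mathrm{id}_Y$. Then for every $(n-1)$-dimensional subspace $Y\subset X$ we have $\lambda(Y,X)>1+\varepsilon_0$,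 where $$\varepsilon_0=\left(m+2\beta^{2p}\right)^{-7}\left(\alpha^{-6}\,2^{14}\,n^{12}\,m^{11}\,p^{4}\right)^{-12pm}.$$ -/

import Mathlib

/-- The relative projection constant `λ(Y, X) = inf ‖P‖` of a subspace `Y` of a real normed space
`X`: the infimum is over all bounded linear operators `P` on `X` with values in `Y` such that
`P y = y` for all `y ∈ Y`.  (As `Y` carries the norm of `X`, it does not matter for `‖P‖` whether
`P` is regarded as an operator into `X` or into `Y`.) -/
noncomputable def relProjConst {X : Type*} [NormedAddCommGroup X] [NormedSpace ℝ X]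
    (Y : Submodule ℝ X) : ℝ :=
  sInf {r : ℝ | ∃ P : X →L[ℝ] X, (∀ x, P x ∈ Y) ∧ (∀ y ∈ Y, P y = y) ∧ r = ‖P‖}

/-- `ℝⁿ` as the underlying real vector space of the normed space whose norm is
`‖x‖ = (∑ i, |f i x| ^ (2 p)) ^ (1 / (2 p))`.  The conditions `0 < p` and `hf` (the functionals
have no common nonzero zero) say exactly that this formula defines a norm. -/
@[nolint unusedArguments]
def FunctionalSpace {n m : ℕ} (f : Fin m → Module.Dual ℝ (Fin n → ℝ)) (p : ℕ) (_hp : 0 < p)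
    (_hf : ∀ x, (∀ i, f i x = 0) → x = 0) : Type :=
  Fin n → ℝ

namespace FunctionalSpace

variable {n m : ℕ} {f : Fin m → Module.Dual ℝ (Fin n → ℝ)} {p : ℕ} {hp : 0 < p}
  {hf : ∀ x, (∀ i, f i x = 0) → x = 0}

instance : AddCommGroup (FunctionalSpace f p hp hf) := inferInstanceAs (AddCommGroup (Fin n → ℝ))

instance : Module ℝ (FunctionalSpace f p hp hf) := inferInstanceAs (Module ℝ (Fin n → ℝ))

instance : Module.Finite ℝ (FunctionalSpace f p hp hf) :=
  inferInstanceAs (Module.Finite ℝ (Fin n → ℝ))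

/-- The functional `f i`, as a linear functional on the space. -/
def functionalLin (hp : 0 < p) (hf : ∀ x, (∀ i, f i x = 0) → x = 0) (i : Fin m) :
    FunctionalSpace f p hp hf →ₗ[ℝ] ℝ :=
  f i

noncomputable instance : Norm (FunctionalSpace f p hp hf) :=
  ⟨fun x => (∑ i, |functionalLin hp hf i x| ^ (2 * p)) ^ (1 / (2 * p : ℝ))⟩

theorem norm_def (x : FunctionalSpace f p hp hf) :
    ‖x‖ = (∑ i, |functionalLin hp hf i x| ^ (2 * p)) ^ (1 / (2 * p : ℝ)) :=
  rfl

theorem norm_core : NormedSpace.Core ℝ (FunctionalSpace f p hp hf) := by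
  have hp1 : (1 : ℝ) ≤ p := by exact_mod_cast hp
  have hsum : ∀ x : FunctionalSpace f p hp hf,
      0 ≤ ∑ i, |functionalLin hp hf i x| ^ (2 * p) := fun x =>
    Finset.sum_nonneg fun i _ => by positivity
  refine ⟨⟨fun x => Real.rpow_nonneg (hsum x) _, fun c x => ?_, fun x y => ?_⟩, fun x => ?_⟩
  · have h : ∑ i, |functionalLin hp hf i (c • x)| ^ (2 * p)
        = |c| ^ (2 * p) * ∑ i, |functionalLin hp hf i x| ^ (2 * p) := by
      simp [Finset.mul_sum, abs_mul, mul_pow]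
    rw [norm_def, norm_def, h, Real.mul_rpow (by positivity) (hsum x), ← Real.rpow_natCast,
      ← Real.rpow_mul (abs_nonneg c), Real.norm_eq_abs]
    have : ((2 * p : ℕ) : ℝ) * (1 / (2 * p : ℝ)) = 1 := by push_cast; field_simp
    rw [this, Real.rpow_one]
  · have h := Real.Lp_add_le (Finset.univ : Finset (Fin m)) (p := (2 * p : ℝ))
      (fun i => functionalLin hp hf i x) (fun i => functionalLin hp hf i y) (by linarith)
    have e : ∀ a : ℝ, |a| ^ (2 * p : ℝ) = |a| ^ (2 * p) := fun a => by
      rw [← Real.rpow_natCast]; push_cast; rfl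
    simp only [e] at h
    simpa only [norm_def, map_add] using h
  · constructor
    · intro h
      rw [norm_def, Real.rpow_eq_zero (hsum x) (by positivity),
        Finset.sum_eq_zero_iff_of_nonneg (fun i _ => by positivity)] at h
      refine hf x fun i => ?_
      have := h i (Finset.mem_univ i)
      exact abs_eq_zero.1 (pow_eq_zero_iff (by omega) |>.1 this)
    · rintro rfl
      rw [norm_def, Real.rpow_eq_zero (hsum 0) (by positivity)]
      refine Finset.sum_eq_zero fun i _ => ?_
      rw [map_zero, abs_zero, zero_pow (by omega)]

noncomputable instance : NormedAddCommGroup (FunctionalSpace f p hp hf) :=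
  NormedAddCommGroup.ofCore norm_core

noncomputable instance : NormedSpace ℝ (FunctionalSpace f p hp hf) :=
  NormedSpace.ofCore norm_core

/-- The functional `f i`, as an element of the dual of the space; the norm on the dual is the
operator norm, that is, the norm dual to `‖x‖`. -/
noncomputable def functional (hp : 0 < p) (hf : ∀ x, (∀ i, f i x = 0) → x = 0) (i : Fin m) :
    StrongDual ℝ (FunctionalSpace f p hp hf) :=
  LinearMap.toContinuousLinearMap (functionalLin hp hf i)

end FunctionalSpace

/-! Suppose some projection onto `Y = ker g` has norm below `1 + 2ε`. A unit vector `w` in its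
kernel is almost Birkhoff orthogonal to `Y`, so the derivative of `‖y + t w‖^(2p)` at `t = 0`,
essentially `∑ F_i(w) F_i(y)^(2p-1)`, is small on the unit ball of `Y`
(`abs_sum_mul_pow_le_of_norm_le`). Polarization makes `∑ F_i(w) ∏_s F_i(v_s)` small for `v_s` in
that ball. As `m - 1 ≤ 2p - 1`, the `v_s` can be chosen so that every `F_j` with `j ≠ i` vanishes at
one of them, which isolates `F_i(w)`. Keeping each `|F_i(v_s)| ≥ α/3` is possible, by Hahn–Banach,
unless `F_i` is close to a plane spanned by `g` and some `F_j`; the distance hypothesis allows at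
most two such `i` (`exists_pair_forall_lt_norm_sub`). So all but two values `F_i(w)` are tiny, the
`β` condition controls the other two, and `‖w‖ < 1`, a contradiction. -/

/-! ### Polarization -/

/-- Expand the power over maps `c : σ → σ`. The signed sum over the sets `S` containing the range of
`c` cancels unless `c` is surjective, hence a permutation. The number of surjections is left
unevaluated: only its positivity matters later. -/
theorem sum_finset_neg_one_pow_mul_sum_pow {σ : Type*} [Fintype σ] [DecidableEq σ] (a : σ → ℝ) :
    ∑ S : Finset σ, (-1 : ℝ) ^ S.card * (∑ s ∈ S, a s) ^ Fintype.card σ =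
      (-1) ^ Fintype.card σ *
        ((Finset.univ.filter fun c : σ → σ => Function.Surjective c).card * ∏ s, a s) := by
  have expand : ∀ S : Finset σ, (∑ s ∈ S, a s) ^ Fintype.card σ =
      ∑ c : σ → σ, (if ∀ k, c k ∈ S then 1 else 0) * ∏ k, a (c k) := by
    intro S
    have := Finset.prod_univ_sum (fun _ : σ => S) (fun _ s => a s)
    rw [Finset.prod_const, Finset.card_univ] at this
    rw [this]
    simp only [ite_mul, one_mul, zero_mul, ← Finset.sum_filter]
    refine Finset.sum_congr ?_ fun _ _ => rfl
    ext c
    simp [Fintype.mem_piFinset]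
  have inner : ∀ c : σ → σ,
      ∑ S : Finset σ, (-1 : ℝ) ^ S.card * (if ∀ k, c k ∈ S then 1 else 0) =
        if Function.Surjective c then (-1) ^ Fintype.card σ else 0 := by
    intro c
    have h := Finset.prod_add (fun _ : σ => (-1 : ℝ))
      (fun s => if s ∈ Set.range c then 0 else 1) Finset.univ
    have hl : (∏ s : σ, ((-1 : ℝ) + if s ∈ Set.range c then 0 else 1)) =
        if Function.Surjective c then (-1) ^ Fintype.card σ else 0 := by
      split_ifs with hc
      · have : ∀ s, s ∈ Set.range c := hc
        simp [this]
      · simp only [Function.Surjective, not_forall] at hc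
        obtain ⟨s, hs⟩ := hc
        refine Finset.prod_eq_zero (Finset.mem_univ s) ?_
        have : s ∉ Set.range c := hs
        simp [this]
    rw [← hl, h, Finset.powerset_univ]
    refine Finset.sum_congr rfl fun S _ => ?_
    rw [Finset.prod_const]
    congr 1
    split_ifs with hS
    · refine (Finset.prod_eq_one fun s hs => ?_).symm
      rw [if_neg]
      rintro ⟨k, rfl⟩
      exact (Finset.mem_sdiff.1 hs).2 (hS k)
    · push Not at hS
      obtain ⟨k, hk⟩ := hS
      refine (Finset.prod_eq_zero (i := c k) (by simp [hk]) ?_).symm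
      simp
  simp only [expand, Finset.mul_sum]
  rw [Finset.sum_comm]
  simp only [← mul_assoc]
  simp only [← Finset.sum_mul, inner]
  simp only [ite_mul, zero_mul, ← Finset.sum_filter]
  rw [mul_assoc, ← nsmul_eq_mul, ← Finset.sum_const, Finset.mul_sum]
  refine Finset.sum_congr rfl fun c hc => ?_
  have hb : Function.Bijective c := Finite.surjective_iff_bijective.1 (Finset.mem_filter.1 hc).2
  rw [hb.prod_comp a]

/-- The factor `2 ^ d` counts subsets; `d ^ d` pays for rescaling partial sums of the `v s` into the
unit ball. -/
theorem abs_sum_mul_prod_le_of_abs_sum_mul_pow_le {X ι : Type*} [NormedAddCommGroup X]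
    [NormedSpace ℝ X] [Fintype ι] (F : ι → StrongDual ℝ X) (Y : Submodule ℝ X) (w : ι → ℝ)
    {d : ℕ} (hd : 0 < d) {η : ℝ} (h : ∀ y ∈ Y, ‖y‖ ≤ 1 → |∑ i, w i * F i y ^ d| ≤ η)
    (v : Fin d → X) (hv : ∀ s, v s ∈ Y) (hv1 : ∀ s, ‖v s‖ ≤ 1) :
    |∑ i, w i * ∏ s, F i (v s)| ≤ (2 * d) ^ d * η := by
  have hη : 0 ≤ η := (abs_nonneg _).trans (h 0 Y.zero_mem (by simp))
  have hd' : (0 : ℝ) < d := by exact_mod_cast hd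
  have bound : ∀ S : Finset (Fin d), |∑ i, w i * (∑ s ∈ S, F i (v s)) ^ d| ≤ d ^ d * η := by
    intro S
    have hn : ‖∑ s ∈ S, v s‖ ≤ d := by
      refine (norm_sum_le_of_le S fun s _ => hv1 s).trans ?_
      simpa using Finset.card_le_univ S
    have := h ((d : ℝ)⁻¹ • ∑ s ∈ S, v s) (Y.smul_mem _ (Y.sum_mem fun s _ => hv s)) (by
      rw [norm_smul, norm_inv, Real.norm_natCast, inv_mul_le_iff₀ hd', mul_one]
      exact hn)
    have e : ∑ i, w i * (∑ s ∈ S, F i (v s)) ^ d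
        = d ^ d * ∑ i, w i * F i ((d : ℝ)⁻¹ • ∑ s ∈ S, v s) ^ d := by
      rw [Finset.mul_sum]
      refine Finset.sum_congr rfl fun i _ => ?_
      rw [map_smul, map_sum, smul_eq_mul, mul_pow, inv_pow]
      field_simp
    rw [e, abs_mul, abs_of_nonneg (by positivity)]
    gcongr
  set N : ℕ := (Finset.univ.filter fun c : Fin d → Fin d => Function.Surjective c).card
  have hN : (1 : ℝ) ≤ N := by
    have : 0 < N := Finset.card_pos.2 ⟨id, by simp [Function.surjective_id]⟩
    exact_mod_cast this
  have key : ∑ S : Finset (Fin d), (-1 : ℝ) ^ S.card * ∑ i, w i * (∑ s ∈ S, F i (v s)) ^ d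
      = (-1) ^ d * (N * ∑ i, w i * ∏ s, F i (v s)) := by
    simp only [Finset.mul_sum]
    rw [Finset.sum_comm]
    refine Finset.sum_congr rfl fun i _ => ?_
    have := sum_finset_neg_one_pow_mul_sum_pow fun s => F i (v s)
    rw [Fintype.card_fin] at this
    calc _ = w i * ∑ S : Finset (Fin d), (-1 : ℝ) ^ S.card * (∑ s ∈ S, F i (v s)) ^ d := by
          rw [Finset.mul_sum]
          exact Finset.sum_congr rfl fun S _ => by ring
      _ = _ := by rw [this]; ring
  calc |∑ i, w i * ∏ s, F i (v s)| ≤ N * |∑ i, w i * ∏ s, F i (v s)| :=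
        le_mul_of_one_le_left (abs_nonneg _) hN
    _ = |(-1) ^ d * (N * ∑ i, w i * ∏ s, F i (v s))| := by simp [abs_mul]
    _ ≤ ∑ S : Finset (Fin d), |(-1 : ℝ) ^ S.card * ∑ i, w i * (∑ s ∈ S, F i (v s)) ^ d| := by
        rw [← key]
        exact Finset.abs_sum_le_sum_abs _ _
    _ ≤ ∑ _S : Finset (Fin d), (d : ℝ) ^ d * η := by
        refine Finset.sum_le_sum fun S _ => ?_
        rw [abs_mul]
        simpa using bound S
    _ = (2 * d) ^ d * η := by simp [mul_pow]; ring

/-! ### First-order consequence of almost orthogonality -/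

theorem abs_add_pow_sub_le {x u : ℝ} (hx : |x| ≤ 1) (hu : |u| ≤ 1) (n : ℕ) :
    |(x + u) ^ n - x ^ n - n * x ^ (n - 1) * u| ≤ 2 ^ n * u ^ 2 := by
  -- The sharper constant obeys `c (n + 1) = 2 * c n + n`, so the induction closes.
  suffices h : |(x + u) ^ n - x ^ n - n * x ^ (n - 1) * u| ≤ (2 ^ n - n - 1) * u ^ 2 by
    refine h.trans (mul_le_mul_of_nonneg_right ?_ (sq_nonneg u))
    linarith [Nat.cast_nonneg (α := ℝ) n]
  induction n with
  | zero => simp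
  | succ n ih =>
    have e : (x + u) ^ (n + 1) - x ^ (n + 1) - ((n + 1 : ℕ) : ℝ) * x ^ (n + 1 - 1) * u =
        (x + u) * ((x + u) ^ n - x ^ n - n * x ^ (n - 1) * u) + n * x ^ (n - 1) * u ^ 2 := by
      cases n with
      | zero => simp
      | succ k => push_cast; ring
    have h1 : |x + u| ≤ 2 := (abs_add_le x u).trans (by linarith)
    have h2 : |x| ^ (n - 1) ≤ 1 := pow_le_one₀ (abs_nonneg x) hx
    rw [e]
    calc _ ≤ |x + u| * |(x + u) ^ n - x ^ n - n * x ^ (n - 1) * u|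
            + n * |x| ^ (n - 1) * u ^ 2 := by
          refine (abs_add_le _ _).trans (le_of_eq ?_)
          simp [abs_mul]
      _ ≤ 2 * ((2 ^ n - n - 1) * u ^ 2) + n * 1 * u ^ 2 := by gcongr
      _ = _ := by push_cast; ring

/-- Test the inequality at `t = ±τ`: the Taylor remainder and the loss from `K` are both of order `τ
^ 2`, so dividing by `τ` bounds the linear term by order `τ`. -/
theorem abs_sum_mul_pow_le_of_norm_le {X ι : Type*} [NormedAddCommGroup X] [NormedSpace ℝ X]
    [Fintype ι] (F : ι → StrongDual ℝ X) {p : ℕ} (hp : 0 < p)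
    (hF : ∀ x, ∑ i, F i x ^ (2 * p) = ‖x‖ ^ (2 * p)) {w y : X} (hw : ‖w‖ ≤ 1) (hy : ‖y‖ ≤ 1)
    (hF1 : ∀ i x, |F i x| ≤ ‖x‖)
    {K τ : ℝ} (hτ0 : 0 < τ) (hτ1 : τ ≤ 1) (hK : K ^ (2 * p) ≤ 1 + τ ^ 2)
    (h : ∀ t : ℝ, ‖y‖ ≤ K * ‖y + t • w‖) :
    |∑ i, F i w * F i y ^ (2 * p - 1)| ≤ 4 ^ p * (Fintype.card ι + 1) * τ := by
  set Q := ∑ i, F i w * F i y ^ (2 * p - 1)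
  have hp1 : (1 : ℝ) ≤ p := by exact_mod_cast hp
  have e4 : (2 : ℝ) ^ (2 * p) = 4 ^ p := by rw [pow_mul]; norm_num
  have step : ∀ t : ℝ, |t| = τ → -(2 * p * t * Q) ≤ 4 ^ p * (Fintype.card ι + 1) * τ ^ 2 := by
    intro t ht
    have ht2 : t ^ 2 = τ ^ 2 := by rw [← sq_abs, ht]
    have hn2 : ‖y + t • w‖ ≤ 2 := by
      refine (norm_add_le _ _).trans ?_
      rw [norm_smul, Real.norm_eq_abs, ht]
      nlinarith [norm_nonneg w]
    have h1 : ‖y‖ ^ (2 * p) ≤ (1 + τ ^ 2) * ‖y + t • w‖ ^ (2 * p) := by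
      calc _ ≤ (K * ‖y + t • w‖) ^ (2 * p) := by gcongr; exact h t
        _ = K ^ (2 * p) * ‖y + t • w‖ ^ (2 * p) := mul_pow _ _ _
        _ ≤ _ := by gcongr
    have h2 : ‖y + t • w‖ ^ (2 * p) ≤ 4 ^ p := by
      rw [← e4]; gcongr
    have h3 : ‖y + t • w‖ ^ (2 * p) ≤
        ‖y‖ ^ (2 * p) + 2 * p * t * Q + 4 ^ p * Fintype.card ι * τ ^ 2 := by
      have hi : ∀ i, F i (y + t • w) ^ (2 * p) ≤ F i y ^ (2 * p)
          + 2 * p * t * (F i w * F i y ^ (2 * p - 1)) + 4 ^ p * τ ^ 2 := by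
        intro i
        have hw1 := (hF1 i w).trans hw
        have hu : |t * F i w| ≤ 1 := by
          rw [abs_mul, ht]; exact mul_le_one₀ hτ1 (abs_nonneg _) hw1
        have := (abs_le.1 (abs_add_pow_sub_le ((hF1 i y).trans hy) hu (2 * p))).2
        have hsq : (t * F i w) ^ 2 ≤ τ ^ 2 := by
          rw [mul_pow, ht2]
          exact mul_le_of_le_one_right (sq_nonneg _) ((sq_le_one_iff_abs_le_one _).2 hw1)
        rw [map_add, map_smul, smul_eq_mul]
        rw [e4] at this
        have h4 : (4 : ℝ) ^ p * (t * F i w) ^ 2 ≤ 4 ^ p * τ ^ 2 := by gcongr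
        push_cast at this
        linarith
      calc _ = ∑ i, F i (y + t • w) ^ (2 * p) := (hF _).symm
        _ ≤ _ := Finset.sum_le_sum fun i _ => hi i
        _ = _ := by
          rw [Finset.sum_add_distrib, Finset.sum_add_distrib, ← Finset.mul_sum, hF]
          simp
          ring
    have h5 : τ ^ 2 * ‖y + t • w‖ ^ (2 * p) ≤ τ ^ 2 * 4 ^ p := by gcongr
    linarith
  have a1 := step τ (abs_of_pos hτ0)
  have a2 := step (-τ) (by rw [abs_neg, abs_of_pos hτ0])
  have a3 : τ * |Q| ≤ τ * (4 ^ p * (Fintype.card ι + 1) * τ) := by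
    have : τ * |Q| ≤ 2 * p * τ * |Q| := by
      have : τ ≤ 2 * p * τ := by nlinarith
      gcongr
    refine this.trans ?_
    rcases abs_cases Q with ⟨hQ, _⟩ | ⟨hQ, _⟩ <;> rw [hQ] <;> linarith
  exact le_of_mul_le_mul_left a3 hτ0

/-! ### Isolating the value of one functional -/

/-- Restrict `φ` to `ker ψ ∩ ker g` and extend by Hahn–Banach; `φ` minus the extension vanishes
there, hence is a combination of `ψ` and `g`. -/
theorem exists_norm_sub_smul_sub_smul_le {X : Type*} [NormedAddCommGroup X] [NormedSpace ℝ X]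
    (φ ψ g : StrongDual ℝ X) {γ : ℝ} (hγ : 0 ≤ γ)
    (h : ∀ v, g v = 0 → ψ v = 0 → |φ v| ≤ γ * ‖v‖) :
    ∃ c s : ℝ, ‖φ - c • ψ - s • g‖ ≤ γ := by
  set Z : Submodule ℝ X := LinearMap.ker (ψ : X →ₗ[ℝ] ℝ) ⊓ LinearMap.ker (g : X →ₗ[ℝ] ℝ)
  obtain ⟨e, he, hen⟩ := exists_extension_norm_eq Z (φ.comp Z.subtypeL)
  have hne : ‖e‖ ≤ γ := by
    rw [hen]
    exact ContinuousLinearMap.opNorm_le_bound _ hγ fun v => h v v.2.2 v.2.1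
  have hmem : ((φ - e : StrongDual ℝ X) : X →ₗ[ℝ] ℝ) ∈
      Submodule.span ℝ (Set.range ![(ψ : X →ₗ[ℝ] ℝ), (g : X →ₗ[ℝ] ℝ)]) := by
    refine mem_span_of_iInf_ker_le_ker fun v hv => ?_
    simp only [Submodule.mem_iInf, Fin.forall_fin_two] at hv
    have := he ⟨v, hv⟩
    simp only [ContinuousLinearMap.comp_apply] at this
    simp [this]
  rw [Matrix.range_cons, Matrix.range_cons, Matrix.range_empty, Set.union_empty,
    Set.singleton_union, Submodule.mem_span_pair] at hmem
  obtain ⟨c, s, hcs⟩ := hmem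
  refine ⟨c, s, ?_⟩
  have : φ - c • ψ - s • g = e := by
    ext v
    have := LinearMap.congr_fun hcs v
    simp at this ⊢
    linarith
  rwa [this]

/-- If every `F i` has distance at least `α` from the span of any three others, then at most two of
the `F i` are within `γ < α / 2` of a plane spanned by `g` and some other `F j`. -/
theorem exists_pair_forall_lt_norm_sub {E ι : Type*} [NormedAddCommGroup E] [NormedSpace ℝ E]
    [Nontrivial ι] (F : ι → E) {α γ : ℝ} (hγ0 : 0 < γ) (hγ : 2 * γ < α)
    (hα : ∀ i j k l, i ≠ j → i ≠ k → i ≠ l → ∀ a b c : ℝ,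
      α ≤ ‖F i - (a • F j + b • F k + c • F l)‖) (g : E) :
    ∃ a b, a ≠ b ∧ ∀ i, i ≠ a → i ≠ b → ∀ j, i ≠ j → ∀ c s : ℝ,
      γ < ‖F i - c • F j - s • g‖ := by
  set bad : ι → Prop := fun i => ∃ j, i ≠ j ∧ ∃ c s : ℝ, ‖F i - c • F j - s • g‖ ≤ γ
  have three : ∀ i k r, bad i → bad k → bad r → i ≠ k → i ≠ r → k ≠ r → False := by
    have hs0 : ∀ i j (c s : ℝ), i ≠ j → ‖F i - c • F j - s • g‖ ≤ γ → 0 < |s| := by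
      rintro i j c s hij h
      rw [abs_pos]
      rintro rfl
      have := hα i j j j hij hij hij c 0 0
      simp only [zero_smul, add_zero, sub_zero] at this h
      linarith
    -- Eliminating `g` between two approximations puts `F i` within `(1 + |s| / |s'|) * γ` of the
    -- span of three others.
    have lt : ∀ i k j l (c s c' s' : ℝ), i ≠ j → i ≠ k → i ≠ l →
        ‖F i - c • F j - s • g‖ ≤ γ → k ≠ l → ‖F k - c' • F l - s' • g‖ ≤ γ → |s'| < |s| := by
      intro i k j l c s c' s' hij hik hil h1 hkl h2
      have hs' := hs0 k l c' s' hkl h2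
      have h0 := hα i j k l hij hik hil c (s / s') (-(s * c' / s'))
      have hs'' : s' ≠ 0 := abs_pos.1 hs'
      have e : F i - (c • F j + (s / s') • F k + (-(s * c' / s')) • F l) =
          (F i - c • F j - s • g) - (s / s') • (F k - c' • F l - s' • g) := by
        have e1 : s / s' * s' = s := by field_simp
        have e2 : s / s' * c' = s * c' / s' := by ring
        rw [smul_sub, smul_sub, smul_smul, smul_smul, e1, e2]
        module
      rw [e] at h0
      have h3 := h0.trans (norm_sub_le _ _)
      rw [norm_smul, Real.norm_eq_abs, abs_div] at h3
      have h4 : α ≤ γ + |s| / |s'| * γ := h3.trans (by gcongr)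
      by_contra! hle
      have : |s| / |s'| ≤ 1 := (div_le_one hs').2 hle
      nlinarith
    rintro i k r ⟨j1, n1, c1, s1, h1⟩ ⟨j2, n2, c2, s2, h2⟩ ⟨j3, n3, c3, s3, h3⟩ hik hir hkr
    have a12 : i ≠ j2 → |s2| < |s1| := fun h => lt i k j1 j2 c1 s1 c2 s2 n1 hik h h1 n2 h2
    have a13 : i ≠ j3 → |s3| < |s1| := fun h => lt i r j1 j3 c1 s1 c3 s3 n1 hir h h1 n3 h3
    have a21 : k ≠ j1 → |s1| < |s2| := fun h => lt k i j2 j1 c2 s2 c1 s1 n2 hik.symm h h2 n1 h1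
    have a23 : k ≠ j3 → |s3| < |s2| := fun h => lt k r j2 j3 c2 s2 c3 s3 n2 hkr h h2 n3 h3
    have a31 : r ≠ j1 → |s1| < |s3| := fun h => lt r i j3 j1 c3 s3 c1 s1 n3 hir.symm h h3 n1 h1
    have a32 : r ≠ j2 → |s2| < |s3| := fun h => lt r k j3 j2 c3 s3 c2 s2 n3 hkr.symm h h3 n2 h2
    clear lt hs0 h1 h2 h3 hα
    generalize |s1| = x at *
    generalize |s2| = y at *
    generalize |s3| = z at *
    -- For each pair of bad indices, one must be the partner of the other. Three pairs and three
    -- partners force a 3-cycle, and the remaining comparisons are then cyclic strict inequalities.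
    by_cases b1 : k = j1 <;> by_cases b2 : i = j2 <;> by_cases b3 : i = j3 <;> grind
  by_cases hb : ∃ a, bad a
  · obtain ⟨a, ha⟩ := hb
    by_cases hb' : ∃ b, b ≠ a ∧ bad b
    · obtain ⟨b, hba, hb⟩ := hb'
      refine ⟨a, b, hba.symm, fun i hia hib j hij c s => ?_⟩
      by_contra! hle
      exact three i a b ⟨j, hij, c, s, hle⟩ ha hb hia hib hba.symm
    · obtain ⟨b, hba⟩ := exists_ne a
      refine ⟨a, b, hba.symm, fun i hia _ j hij c s => ?_⟩
      by_contra! hle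
      exact hb' ⟨i, hia, j, hij, c, s, hle⟩
  · obtain ⟨a, b, hab⟩ := exists_pair_ne ι
    refine ⟨a, b, hab, fun i _ _ j hij c s => ?_⟩
    by_contra! hle
    exact hb ⟨i, j, hij, c, s, hle⟩

theorem abs_mul_pow_le_of_forall_exists_apply_eq_zero {X ι : Type*} [NormedAddCommGroup X]
    [NormedSpace ℝ X] [Fintype ι] [Nontrivial ι] (F : ι → StrongDual ℝ X) (Y : Submodule ℝ X)
    (w : ι → ℝ) {d : ℕ} (hd : 0 < d) (hcard : Fintype.card ι ≤ d + 1) {η γ : ℝ} (hγ : 0 ≤ γ)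
    (h : ∀ y ∈ Y, ‖y‖ ≤ 1 → |∑ i, w i * F i y ^ d| ≤ η) (i : ι)
    (hi : ∀ j, j ≠ i → ∃ v ∈ Y, ‖v‖ ≤ 1 ∧ F j v = 0 ∧ γ ≤ |F i v|) :
    |w i| * γ ^ d ≤ (2 * d) ^ d * η := by
  classical
  have : Nonempty {j // j ≠ i} := let ⟨j, hj⟩ := exists_ne i; ⟨⟨j, hj⟩⟩
  have hc : Fintype.card {j // j ≠ i} ≤ Fintype.card (Fin d) := by
    rw [Fintype.card_subtype_compl, Fintype.card_fin, Fintype.card_subtype_eq]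
    omega
  -- A left inverse of `φ` maps `Fin d` onto the indices other than `i`; repetitions are harmless.
  obtain ⟨φ⟩ := Function.Embedding.nonempty_of_card_le hc
  have hq := Function.invFun_surjective φ.injective
  set q := Function.invFun φ
  choose v hvY hv1 hv0 hvi using fun s : Fin d => hi (q s) (q s).2
  have key := abs_sum_mul_prod_le_of_abs_sum_mul_pow_le F Y w hd h v hvY hv1
  rw [Finset.sum_eq_single i, abs_mul, Finset.abs_prod] at key
  · refine le_trans ?_ key
    gcongr
    simpa using Finset.prod_le_prod (s := Finset.univ) (fun _ _ => hγ) fun s _ => hvi s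
  · intro j _ hj
    obtain ⟨s, hs⟩ := hq ⟨j, hj⟩
    rw [Finset.prod_eq_zero (Finset.mem_univ s), mul_zero]
    simpa [hs] using hv0 s
  · simp

/-- If a unit vector `w` is almost orthogonal to the hyperplane `ker g`, then the values `F i w` are
small except for at most two indices. -/
theorem exists_pair_forall_abs_apply_mul_pow_le {X ι : Type*} [NormedAddCommGroup X]
    [NormedSpace ℝ X] [Fintype ι] [Nontrivial ι] (F : ι → StrongDual ℝ X) {d : ℕ} (hd : 0 < d)
    (hcard : Fintype.card ι ≤ d + 1) {α η : ℝ} (hα0 : 0 < α)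
    (hα : ∀ i j k l, i ≠ j → i ≠ k → i ≠ l → ∀ a b c : ℝ,
      α ≤ ‖F i - (a • F j + b • F k + c • F l)‖) (g : StrongDual ℝ X) (w : ι → ℝ)
    (h : ∀ y, g y = 0 → ‖y‖ ≤ 1 → |∑ i, w i * F i y ^ d| ≤ η) :
    ∃ a b, a ≠ b ∧ ∀ i, i ≠ a → i ≠ b → |w i| * (α / 3) ^ d ≤ (2 * d) ^ d * η := by
  obtain ⟨a, b, hab, hgood⟩ := exists_pair_forall_lt_norm_sub F (γ := α / 3) (by positivity)
    (by linarith) hα g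
  refine ⟨a, b, hab, fun i hia hib => ?_⟩
  refine abs_mul_pow_le_of_forall_exists_apply_eq_zero F (LinearMap.ker (g : X →ₗ[ℝ] ℝ)) w hd hcard
    (by positivity) (fun y hy => h y hy) i fun j hj => ?_
  by_contra! hno
  obtain ⟨c, s, hcs⟩ := exists_norm_sub_smul_sub_smul_le (F i) (F j) g
    (γ := α / 3) (by positivity) fun v hgv hjv => by
      rcases eq_or_ne v 0 with rfl | hv
      · simp
      have hv' : 0 < ‖v‖ := norm_pos_iff.2 hv
      have := hno (‖v‖⁻¹ • v) (by simpa using Or.inr hgv)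
        (by rw [norm_smul, norm_inv, norm_norm, inv_mul_cancel₀ hv'.ne']) (by simp [hjv])
      rw [map_smul, smul_eq_mul, abs_mul, abs_inv, abs_norm, inv_mul_lt_iff₀ hv'] at this
      linarith
  exact absurd hcs (not_le.2 (hgood i hia hib j hj.symm c s))

/-! ### Numerical estimates -/

theorem one_add_pow_le_one_add_two_pow_mul {x : ℝ} (h0 : 0 ≤ x) (h1 : x ≤ 1) (n : ℕ) :
    (1 + x) ^ n ≤ 1 + 2 ^ n * x := by
  suffices h : (1 + x) ^ n ≤ 1 + (2 ^ n - 1) * x by linarith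
  induction n with
  | zero => simp
  | succ n ih =>
    have h2 : (0 : ℝ) ≤ 2 ^ n - 1 := sub_nonneg.2 (one_le_pow₀ (by norm_num))
    rw [pow_succ, pow_succ]
    have h3 : (2 ^ n - 1) * (x * x) ≤ (2 ^ n - 1) * x :=
      mul_le_mul_of_nonneg_left (by nlinarith) h2
    nlinarith [mul_le_mul_of_nonneg_right ih (by linarith : 0 ≤ 1 + x)]

/-- The spare factor `A⁻¹` absorbs the `2`. -/
theorem two_mul_zpow_mul_zpow_le_sq {A B : ℝ} (hA : 2 ≤ A) (hB : 1 ≤ B) (p m : ℕ) :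
    2 * (A ^ (-7 : ℤ) * B ^ (-(12 * (p : ℤ) * (m : ℤ)))) ≤ ((A ^ 3)⁻¹ * (B ^ (6 * p * m))⁻¹) ^ 2 := by
  have e1 : A ^ (-7 : ℤ) = (A ^ 7)⁻¹ := by rw [zpow_neg]; norm_cast
  have e2 : B ^ (-(12 * (p : ℤ) * (m : ℤ))) = (B ^ (12 * p * m))⁻¹ := by rw [zpow_neg]; norm_cast
  have e3 : ((A ^ 3)⁻¹ * (B ^ (6 * p * m))⁻¹) ^ 2 = (A ^ 6)⁻¹ * (B ^ (12 * p * m))⁻¹ := by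
    rw [mul_pow, inv_pow, inv_pow, ← pow_mul, ← pow_mul]
    congr 3
    ring
  rw [e1, e2, e3, ← mul_assoc]
  have : 2 * (A ^ 7)⁻¹ ≤ (A ^ 6)⁻¹ := by
    rw [pow_succ, mul_inv]
    have h6 : 0 ≤ (A ^ 6)⁻¹ := by positivity
    have h2 : 2 * A⁻¹ ≤ 1 := by
      rw [← div_eq_mul_inv, div_le_one (by linarith)]; exact hA
    nlinarith
  gcongr

theorem mul_two_mul_pow_mul_div_pow_lt_one {A B α : ℝ} {p m : ℕ} (hA : 2 ≤ A) (hp : 0 < p)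
    (hm : 1 ≤ m) (hα0 : 0 < α) (hα1 : α ≤ 1) (hB : 192 * (p * m / α) ≤ B) :
    A * ((2 * (2 * p - 1 : ℕ)) ^ (2 * p - 1) *
      (4 ^ p * (m + 1) * (2 ^ p * ((A ^ 3)⁻¹ * (B ^ (6 * p * m))⁻¹))) /
        (α / 3) ^ (2 * p - 1)) < 1 := by
  have hp1 : (1 : ℝ) ≤ p := by exact_mod_cast hp
  have hm1 : (1 : ℝ) ≤ m := by exact_mod_cast hm
  have hpm : 1 ≤ p * m / α := by
    rw [one_le_div hα0]; nlinarith
  have hB1 : 1 ≤ B := by linarith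
  have hα3 : 1 ≤ 3 / α := by rw [one_le_div hα0]; linarith
  have h1 : (2 * (2 * p - 1 : ℕ) : ℝ) ^ (2 * p - 1) ≤ (4 * p) ^ (2 * p) := by
    calc (2 * (2 * p - 1 : ℕ) : ℝ) ^ (2 * p - 1) ≤ (4 * p) ^ (2 * p - 1) := by
          refine pow_le_pow_left₀ (by positivity) ?_ _
          exact_mod_cast (by omega : 2 * (2 * p - 1) ≤ 4 * p)
      _ ≤ _ := pow_le_pow_right₀ (by linarith) (by omega)
  have h2 : (4 : ℝ) ^ p * 2 ^ p ≤ 8 ^ (2 * p) := by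
    rw [← mul_pow]
    norm_num
    exact pow_le_pow_right₀ (by norm_num) (by omega)
  have h3 : (m + 1 : ℝ) ≤ (2 * m) ^ (2 * p) := by
    calc (m + 1 : ℝ) ≤ 2 * m := by linarith
      _ ≤ _ := le_self_pow₀ (by linarith) (by omega)
  have h4 : ((α / 3) ^ (2 * p - 1))⁻¹ ≤ (3 / α) ^ (2 * p) := by
    rw [← inv_pow, inv_div]
    exact pow_le_pow_right₀ hα3 (by omega)
  have h5 : B ^ (2 * p) ≤ B ^ (6 * p * m) := by
    refine pow_le_pow_right₀ hB1 ?_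
    nlinarith
  -- The source of `192 = 4 * 8 * 2 * 3`.
  have h6 : (4 * p : ℝ) ^ (2 * p) * 8 ^ (2 * p) * (2 * m) ^ (2 * p) * (3 / α) ^ (2 * p)
      ≤ B ^ (6 * p * m) := by
    refine le_trans ?_ h5
    rw [← mul_pow, ← mul_pow, ← mul_pow]
    refine pow_le_pow_left₀ (by positivity) ?_ _
    refine le_trans (le_of_eq ?_) hB
    ring
  have hA0 : 0 < A := by linarith
  have hA2 : A * (A ^ 3)⁻¹ < 1 := by
    rw [← div_eq_mul_inv, div_lt_one (by positivity)]
    nlinarith [mul_pos hA0 hA0]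
  have hBp : 0 < B ^ (6 * p * m) := by positivity
  calc _ = A * (A ^ 3)⁻¹ * ((2 * (2 * p - 1 : ℕ) : ℝ) ^ (2 * p - 1) * (4 ^ p * 2 ^ p) * (m + 1) *
        ((α / 3) ^ (2 * p - 1))⁻¹ * (B ^ (6 * p * m))⁻¹) := by ring
    _ ≤ A * (A ^ 3)⁻¹ * ((4 * p : ℝ) ^ (2 * p) * 8 ^ (2 * p) * (2 * m) ^ (2 * p) *
        (3 / α) ^ (2 * p) * (B ^ (6 * p * m))⁻¹) := by gcongr
    _ ≤ A * (A ^ 3)⁻¹ * (B ^ (6 * p * m) * (B ^ (6 * p * m))⁻¹) := by gcongr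
    _ = A * (A ^ 3)⁻¹ := by rw [mul_inv_cancel₀ hBp.ne', mul_one]
    _ < 1 := hA2

/-! ### The given norm and its functionals -/

namespace FunctionalSpace

variable {n m p : ℕ} {f : Fin m → Module.Dual ℝ (Fin n → ℝ)} {hp : 0 < p}
  {hf : ∀ x, (∀ i, f i x = 0) → x = 0}

theorem sum_functional_pow (x : FunctionalSpace f p hp hf) :
    ∑ i, functional hp hf i x ^ (2 * p) = ‖x‖ ^ (2 * p) := by
  have h0 : 0 ≤ ∑ i, |functionalLin hp hf i x| ^ (2 * p) :=
    Finset.sum_nonneg fun i _ => by positivity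
  have hp' : (p : ℝ) ≠ 0 := by exact_mod_cast hp.ne'
  rw [norm_def, ← Real.rpow_natCast, ← Real.rpow_mul h0]
  have : 1 / (2 * p : ℝ) * ((2 * p : ℕ) : ℝ) = 1 := by push_cast; field_simp
  rw [this, Real.rpow_one]
  exact Finset.sum_congr rfl fun i _ => ((even_two_mul p).pow_abs _).symm

theorem abs_functional_le (i : Fin m) (x : FunctionalSpace f p hp hf) :
    |functional hp hf i x| ≤ ‖x‖ := by
  refine le_of_pow_le_pow_left₀ (n := 2 * p) (by omega) (norm_nonneg x) ?_
  rw [(even_two_mul p).pow_abs, ← sum_functional_pow]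
  exact Finset.single_le_sum (f := fun i => functional hp hf i x ^ (2 * p))
    (fun j _ => (even_two_mul p).pow_nonneg _) (Finset.mem_univ i)

theorem finrank_eq : Module.finrank ℝ (FunctionalSpace f p hp hf) = n :=
  (Module.finrank_fin_fun ℝ : Module.finrank ℝ (Fin n → ℝ) = n)

theorem le_norm_functional_sub {α : ℝ} (hm : 4 ≤ m)
    (hα : ∀ j k l : Fin m, j < k → k < l → ∀ i : Fin m, i ≠ j → i ≠ k → i ≠ l →
      α ≤ Metric.infDist (functional hp hf i)
        (Submodule.span ℝ {functional hp hf j, functional hp hf k, functional hp hf l} :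
          Set (StrongDual ℝ (FunctionalSpace f p hp hf))))
    (i j k l : Fin m) (hij : i ≠ j) (hik : i ≠ k) (hil : i ≠ l) (a b c : ℝ) :
    α ≤ ‖functional hp hf i -
      (a • functional hp hf j + b • functional hp hf k + c • functional hp hf l)‖ := by
  -- Here `j`, `k`, `l` may coincide or be unordered, so they are enlarged to three distinct indices
  -- avoiding `i`, then sorted.
  obtain ⟨T, hT, hTi, hT3⟩ := Finset.exists_subsuperset_card_eq
    (s := {j, k, l}) (t := Finset.univ.erase i) (n := 3)
    (by intro x; simp only [Finset.mem_insert, Finset.mem_singleton]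
        rintro (rfl | rfl | rfl) <;> simp [hij.symm, hik.symm, hil.symm])
    Finset.card_le_three (by simp; omega)
  set e := T.orderEmbOfFin hT3
  have hei : ∀ t, i ≠ e t := fun t =>
    ((Finset.mem_erase.1 (hTi (T.orderEmbOfFin_mem hT3 t))).1).symm
  have h := hα (e 0) (e 1) (e 2) (e.strictMono (by decide)) (e.strictMono (by decide)) i
    (hei 0) (hei 1) (hei 2)
  have hmem : ∀ x ∈ T, functional hp hf x ∈ Submodule.span ℝ
      {functional hp hf (e 0), functional hp hf (e 1), functional hp hf (e 2)} := by
    intro x hx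
    have : x ∈ Set.range e := by rw [Finset.range_orderEmbOfFin]; exact hx
    obtain ⟨t, rfl⟩ := this
    apply Submodule.subset_span
    fin_cases t <;> simp
  refine h.trans ((Metric.infDist_le_dist_of_mem ?_).trans_eq (dist_eq_norm _ _))
  exact Submodule.add_mem _ (Submodule.add_mem _
    (Submodule.smul_mem _ _ (hmem j (hT (by simp)))) (Submodule.smul_mem _ _ (hmem k (hT (by simp)))))
    (Submodule.smul_mem _ _ (hmem l (hT (by simp))))

theorem norm_pow_le_of_forall_abs_functional_le {β σ : ℝ} (hm : 3 ≤ m) (hβ0 : 0 ≤ β)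
    (hσ : 0 ≤ σ)
    (hβ : ∀ j k : Fin m, j < k → ∀ x : Fin n → ℝ,
      max |f j x| |f k x| ≤ β * ⨆ i : {i : Fin m // i ≠ j ∧ i ≠ k}, |f i x|)
    (x : FunctionalSpace f p hp hf) {a b : Fin m} (hab : a ≠ b)
    (hx : ∀ i, i ≠ a → i ≠ b → |functional hp hf i x| ≤ σ) :
    ‖x‖ ^ (2 * p) ≤ ((m : ℝ) + 2 * β ^ (2 * p)) * σ ^ (2 * p) := by
  wlog hlt : a < b generalizing a b
  · exact this hab.symm (fun i h1 h2 => hx i h2 h1) (lt_of_le_of_ne (not_lt.1 hlt) hab.symm)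
  have hne : Nonempty {i : Fin m // i ≠ a ∧ i ≠ b} := by
    obtain ⟨i, hi⟩ := Finset.exists_mem_notMem_of_card_lt_card
      (s := {a, b}) (t := (Finset.univ : Finset (Fin m)))
      (by rw [Finset.card_pair hab]; simp; omega)
    simp at hi
    exact ⟨i, hi⟩
  have hsup : max |f a x| |f b x| ≤ β * σ :=
    (hβ a b hlt x).trans (mul_le_mul_of_nonneg_left (ciSup_le fun i => hx i i.2.1 i.2.2) hβ0)
  have ha : |functional hp hf a x| ≤ β * σ := (le_max_left _ _).trans hsup
  have hb : |functional hp hf b x| ≤ β * σ := (le_max_right _ _).trans hsup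
  have hi : ∀ i, functional hp hf i x ^ (2 * p) ≤ σ ^ (2 * p) +
      ((if i = a then (β * σ) ^ (2 * p) else 0) + if i = b then (β * σ) ^ (2 * p) else 0) := by
    intro i
    have h0 : 0 ≤ σ ^ (2 * p) := by positivity
    have h1 : 0 ≤ (β * σ) ^ (2 * p) := by positivity
    rw [← (even_two_mul p).pow_abs]
    by_cases hia : i = a
    · subst hia
      have := pow_le_pow_left₀ (abs_nonneg _) ha (2 * p)
      rw [if_pos rfl]
      split_ifs <;> linarith
    · by_cases hib : i = b
      · subst hib
        have := pow_le_pow_left₀ (abs_nonneg _) hb (2 * p)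
        rw [if_pos rfl, if_neg hia]
        linarith
      · have := pow_le_pow_left₀ (abs_nonneg _) (hx i hia hib) (2 * p)
        rw [if_neg hia, if_neg hib]
        linarith
  rw [← sum_functional_pow]
  refine (Finset.sum_le_sum fun i _ => hi i).trans (le_of_eq ?_)
  rw [Finset.sum_add_distrib, Finset.sum_add_distrib]
  simp [mul_pow]
  ring

end FunctionalSpace

/-! ### Projections onto hyperplanes and the main estimate -/

/-- A projection onto a proper subspace with norm at most `K` yields a unit vector which is
`K`-almost Birkhoff orthogonal to the subspace. -/
theorem exists_norm_eq_one_forall_norm_le_of_projection {X : Type*} [NormedAddCommGroup X]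
    [NormedSpace ℝ X] {Y : Submodule ℝ X} (hY : Y ≠ ⊤) (P : X →L[ℝ] X) (hPY : ∀ x, P x ∈ Y)
    (hP : ∀ y ∈ Y, P y = y) {K : ℝ} (hK : ‖P‖ ≤ K) :
    ∃ w : X, ‖w‖ = 1 ∧ ∀ y ∈ Y, ∀ t : ℝ, ‖y‖ ≤ K * ‖y + t • w‖ := by
  obtain ⟨x, -, hx⟩ := SetLike.exists_of_lt (lt_top_iff_ne_top.2 hY)
  have h0 : x - P x ≠ 0 := fun h => hx (by rw [sub_eq_zero.1 h]; exact hPY x)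
  refine ⟨‖x - P x‖⁻¹ • (x - P x), ?_, fun y hy t => ?_⟩
  · rw [norm_smul, norm_inv, norm_norm, inv_mul_cancel₀ (norm_ne_zero_iff.2 h0)]
  · have h1 : P (x - P x) = 0 := by rw [map_sub, hP _ (hPY x), sub_self]
    calc ‖y‖ = ‖P (y + t • ‖x - P x‖⁻¹ • (x - P x))‖ := by
          rw [map_add, map_smul, map_smul, h1, smul_zero, smul_zero, add_zero, hP y hy]
      _ ≤ _ := P.le_of_opNorm_le hK _

theorem exists_projection {X : Type*} [NormedAddCommGroup X] [NormedSpace ℝ X]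
    [FiniteDimensional ℝ X] (Y : Submodule ℝ X) :
    ∃ P : X →L[ℝ] X, (∀ x, P x ∈ Y) ∧ ∀ y ∈ Y, P y = y := by
  obtain ⟨q, hq⟩ := Y.subtype.exists_leftInverse_of_injective Y.ker_subtype
  exact ⟨LinearMap.toContinuousLinearMap (Y.subtype ∘ₗ q), fun x => (q x).2,
    fun y hy => congrArg Subtype.val (LinearMap.congr_fun hq ⟨y, hy⟩)⟩

theorem exists_dual_ker_eq_of_finrank_add_one {X : Type*} [NormedAddCommGroup X] [NormedSpace ℝ X]
    [FiniteDimensional ℝ X] {Y : Submodule ℝ X}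
    (hY : Module.finrank ℝ Y + 1 = Module.finrank ℝ X) :
    ∃ g : StrongDual ℝ X, ∀ y, g y = 0 ↔ y ∈ Y := by
  have hlt : Y < ⊤ := lt_top_iff_ne_top.2 fun h => by
    rw [h, finrank_top] at hY
    omega
  obtain ⟨g, hg0, hg⟩ := Y.exists_le_ker_of_lt_top hlt
  have h1 := Module.Dual.finrank_ker_add_one_of_ne_zero hg0
  have h2 : Y = LinearMap.ker g := Submodule.eq_of_le_of_finrank_eq hg (by omega)
  refine ⟨LinearMap.toContinuousLinearMap g, fun y => ?_⟩
  rw [h2]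
  rfl

theorem theorem1p1 (n m p : ℕ) (hn : 4 ≤ n) (hm : n + 2 ≤ m) (hmp : (m : ℝ) / 2 ≤ p)
    (hp : 0 < p)
    (f : Fin m → Module.Dual ℝ (Fin n → ℝ)) (hf0 : ∀ i, f i ≠ 0)
    (hf : ∀ x, (∀ i, f i x = 0) → x = 0)
    (α : ℝ) (hα0 : 0 < α) (hα1 : α ≤ 1 / 2)
    (hα : ∀ j k l : Fin m, j < k → k < l → ∀ i : Fin m, i ≠ j → i ≠ k → i ≠ l →
      α ≤ Metric.infDist (FunctionalSpace.functional hp hf i)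
        (Submodule.span ℝ {FunctionalSpace.functional hp hf j, FunctionalSpace.functional hp hf k,
          FunctionalSpace.functional hp hf l} :
            Set (StrongDual ℝ (FunctionalSpace f p hp hf))))
    (β : ℝ) (hβ0 : 0 < β)
    (hβ : ∀ j k : Fin m, j < k → ∀ x : Fin n → ℝ,
      max |f j x| |f k x| ≤ β * ⨆ i : {i : Fin m // i ≠ j ∧ i ≠ k}, |f i x|)
    (Y : Submodule ℝ (FunctionalSpace f p hp hf)) (hY : Module.finrank ℝ Y = n - 1) :
    relProjConst Y > 1 + ((m : ℝ) + 2 * β ^ (2 * p)) ^ (-7 : ℤ) *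
      (α ^ (-6 : ℤ) * 2 ^ 14 * (n : ℝ) ^ 12 * (m : ℝ) ^ 11 * (p : ℝ) ^ 4) ^
        (-(12 * (p : ℤ) * (m : ℤ))) := by
  set A : ℝ := (m : ℝ) + 2 * β ^ (2 * p) with hAdef
  set B : ℝ := α ^ (-6 : ℤ) * 2 ^ 14 * (n : ℝ) ^ 12 * (m : ℝ) ^ 11 * (p : ℝ) ^ 4 with hBdef
  set ε : ℝ := A ^ (-7 : ℤ) * B ^ (-(12 * (p : ℤ) * (m : ℤ)))
  have hn1 : (1 : ℝ) ≤ n := by exact_mod_cast (by omega : 1 ≤ n)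
  have hm2 : (2 : ℝ) ≤ m := by exact_mod_cast (by omega : 2 ≤ m)
  have hp1 : (1 : ℝ) ≤ p := by exact_mod_cast hp
  have hA : 2 ≤ A := by
    have : 0 < β ^ (2 * p) := by positivity
    linarith
  have hB : 192 * (p * m / α) ≤ B := by
    have e : α ^ (-6 : ℤ) = (α⁻¹) ^ 6 := by rw [zpow_neg, inv_pow]; norm_cast
    have h1 : α⁻¹ ≤ (α⁻¹) ^ 6 :=
      le_self_pow₀ ((one_le_inv₀ hα0).2 (by linarith)) (by norm_num)
    have h2 : (m : ℝ) ≤ m ^ 11 := le_self_pow₀ (by linarith) (by norm_num)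
    have h3 : (p : ℝ) ≤ p ^ 4 := le_self_pow₀ hp1 (by norm_num)
    have h4 : (1 : ℝ) ≤ n ^ 12 := one_le_pow₀ hn1
    calc 192 * (p * m / α) = α⁻¹ * 192 * 1 * m * p := by ring
      _ ≤ (α⁻¹) ^ 6 * 2 ^ 14 * (n : ℝ) ^ 12 * (m : ℝ) ^ 11 * (p : ℝ) ^ 4 := by
        gcongr
        norm_num
      _ = B := by rw [hBdef, e]
  have hpm : 2 ≤ p * m / α := by
    rw [le_div_iff₀ hα0]; nlinarith
  have hB1 : 2 ≤ B := by linarith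
  have hε : 0 < ε := by positivity
  set τ₀ : ℝ := (A ^ 3)⁻¹ * (B ^ (6 * p * m))⁻¹
  have hτ₀ : 0 < τ₀ := by positivity
  have hετ : 2 * ε ≤ τ₀ ^ 2 := two_mul_zpow_mul_zpow_le_sq hA (by linarith) p m
  have hτ1 : 2 ^ p * τ₀ ≤ 1 := by
    have h1 : (2 : ℝ) ^ p ≤ B ^ (6 * p * m) := by
      calc (2 : ℝ) ^ p ≤ B ^ p := by gcongr
        _ ≤ _ := pow_le_pow_right₀ (by linarith) (by
          have : 1 ≤ m := by omega
          nlinarith)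
    have h2 : (A ^ 3)⁻¹ ≤ 1 := inv_le_one_of_one_le₀ (one_le_pow₀ (by linarith))
    have hBp : 0 < B ^ (6 * p * m) := by positivity
    calc 2 ^ p * ((A ^ 3)⁻¹ * (B ^ (6 * p * m))⁻¹) ≤ B ^ (6 * p * m) * (1 * (B ^ (6 * p * m))⁻¹) := by gcongr
      _ = 1 := by rw [one_mul, mul_inv_cancel₀ hBp.ne']
  set σ : ℝ := (2 * (2 * p - 1 : ℕ)) ^ (2 * p - 1) * (4 ^ p * (m + 1) * (2 ^ p * τ₀)) /
    (α / 3) ^ (2 * p - 1) with hσdef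
  have hσ0 : 0 ≤ σ := by positivity
  have hAσ : A * σ < 1 :=
    mul_two_mul_pow_mul_div_pow_lt_one hA hp (by omega) hα0 (by linarith) hB
  -- An infimum only inherits a weak bound; the extra `ε` makes the final inequality strict.
  have hle : 1 + 2 * ε ≤ relProjConst Y := by
    refine le_csInf ?_ ?_
    · obtain ⟨P, h1, h2⟩ := exists_projection Y
      exact ⟨_, P, h1, h2, rfl⟩
    rintro _ ⟨P, hPY, hP, rfl⟩
    by_contra! hlt
    obtain ⟨g, hg⟩ := exists_dual_ker_eq_of_finrank_add_one (Y := Y)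
      (by rw [hY, FunctionalSpace.finrank_eq]; omega)
    have hYtop : Y ≠ ⊤ := by
      rintro rfl
      rw [finrank_top, FunctionalSpace.finrank_eq] at hY
      omega
    obtain ⟨w, hw1, hw⟩ := exists_norm_eq_one_forall_norm_le_of_projection hYtop P hPY hP hlt.le
    have hτ₀1 : τ₀ ≤ 1 :=
      (le_mul_of_one_le_left hτ₀.le (one_le_pow₀ (by norm_num))).trans hτ1
    -- This fixes the step size `τ = 2 ^ p * τ₀`, with `τ₀ ^ 2` dominating `2 * ε`.
    have hK : (1 + 2 * ε) ^ (2 * p) ≤ 1 + (2 ^ p * τ₀) ^ 2 := by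
      refine (one_add_pow_le_one_add_two_pow_mul (by positivity) (by nlinarith) _).trans ?_
      rw [mul_pow, ← pow_mul, mul_comm p 2]
      gcongr
    have hη : ∀ y, g y = 0 → ‖y‖ ≤ 1 →
        |∑ i, FunctionalSpace.functional hp hf i w *
          FunctionalSpace.functional hp hf i y ^ (2 * p - 1)| ≤
            4 ^ p * (m + 1) * (2 ^ p * τ₀) := by
      intro y hgy hy1
      have := abs_sum_mul_pow_le_of_norm_le (FunctionalSpace.functional hp hf) hp
        FunctionalSpace.sum_functional_pow hw1.le hy1 FunctionalSpace.abs_functional_le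
        (by positivity) hτ1 hK (hw y ((hg y).1 hgy))
      simpa using this
    have : Nontrivial (Fin m) := Fin.nontrivial_iff_two_le.2 (by omega)
    obtain ⟨a, b, hab, hsmall⟩ := exists_pair_forall_abs_apply_mul_pow_le
      (FunctionalSpace.functional hp hf) (d := 2 * p - 1) (by omega)
      (by
        rw [Fintype.card_fin]
        have : (m : ℝ) ≤ 2 * p := by linarith
        have : m ≤ 2 * p := by exact_mod_cast this
        omega)
      hα0 (FunctionalSpace.le_norm_functional_sub (by omega) hα) g _ hη
    have hfin := FunctionalSpace.norm_pow_le_of_forall_abs_functional_le (by omega) hβ0.le hσ0 hβ w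
      hab fun i hia hib => by
        rw [hσdef, le_div_iff₀ (by positivity)]
        exact hsmall i hia hib
    rw [hw1, one_pow, ← hAdef] at hfin
    have hσ1 : σ ≤ 1 := by nlinarith
    have : A * σ ^ (2 * p) ≤ A * σ := by
      gcongr
      exact pow_le_of_le_one hσ0 hσ1 (by omega)
    linarith
  linarith
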